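/- **Definitions.** Let $\mathbb{A}$ be a small category. For a presheaf $Y:\mathbb{A}^{\mathrm{op}}\to\mathbf{Set}$ and a functor $X$ from $\mathbb{A}$ to $\mathbf{Set}$ or $\mathbf{Top}$, let $Y\otimes X=\int^{b}Y(b)\times X(b)=\bigl(\sum_b Y(b)\times X(b)\bigr)/\!\sim$, where $\sim$ is generated by $(yg,x)\sim(y,gx)$ (in $\mathbf{Top}$, with the quotient topology, each $Y(b)$ being discrete); the class of $(y,x)$ is written $y\otimes x$. A functor $X:\mathbb{A}\to\mathbf{Set}$ is *nondegenerate* if $-\otimes X:[\mathbb{A}^{\mathrm{op}},\mathbf{Set}]\to\mathbf{Set}$ preserves finite connected limits; a functor $X:\mathbb{A}\to\mathbf{Top}$ is *nondegenerate* if its underlying functor to $\mathbf{Set}$ is nondegenerate and $Xf$ is a closed map for every map $f$ of $\mathbb{A}$. A module $M$ on $\mathbb{A}$ is a functor $M:\mathbb{A}^{\mathrm{op}}\times\mathbb{A}\to\mathbf{Set}$. The pair $(\mathbb{A},M)$ is an *equational system* if for each $a$ the category of elements of $M(-,a)$ is finite (has only finitely many arrows), and for each $b$ the functor $M(b,-)$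 is nondegenerate. Let $(M\otimes X)(a)=M(-,a)\otimes X$. An *$M$-coalgebra in $\mathbf{Top}$* is a nondegenerate functor $X:\mathbb{A}\to\mathbf{Top}$ together with a natural transformation $X\to M\otimes X$; maps of coalgebras are the natural transformations commuting with the structure maps. A *universal solution* of $(\mathbb{A},M)$ in $\mathbf{Top}$ is a terminal $M$-coalgebra in $\mathbf{Top}$. Let $\Delta_{\mathrm{inj}}$ be the category of the sets $[n]=\{0,\dots,n\}$ ($n\in\mathbb{N}$) and order-preserving injections. Let $$M([n],[m])=\{\text{chains } \emptyset\subset Q(0)\subset\cdots\subset Q(n)\subseteq[m]\ \text{of subsets of } [m]\}$$ with strict inclusions $\subset$; for $f:[m]\to[m']$ and $g:[n']\to[n]$ put $(fQg)(j)=f(Q(g(j)))$ (direct image). Let $\Delta^{\bullet}:\Delta_{\mathrm{inj}}\to\mathbf{Top}$ be the standard simplex functor: $\Delta^n$ is the standard topological $n$-simplex with vertices $e^n_0,\dots,e^n_n$, and $f:[n]\to[m]$ induces the affine map with $e^n_j\mapsto e^m_{f(j)}$. For $Q\in M([n],[m])$ let $\psi_Q:\Delta^n\to\Delta^m$ be the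 affine map with $e^n_j\mapsto\frac{1}{|Q(j)|}\sum_{i\in Q(j)}e^m_i$. These maps determine a natural transformation $\psi:M\otimes\Delta^{\bullet}\to\Delta^{\bullet}$, $\psi(Q\otimes t)=\psi_Q(t)$. **Theorem.** $(\Delta_{\mathrm{inj}},M)$ is an equational system; the functor $\Delta^{\bullet}:\Delta_{\mathrm{inj}}\to\mathbf{Top}$ is nondegenerate; $\psi:M\otimes\Delta^{\bullet}\to\Delta^{\bullet}$ is an isomorphism; and $(\Delta^{\bullet},\psi^{-1})$ is the universal solution of $(\Delta_{\mathrm{inj}},M)$ in $\mathbf{Top}$. -/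

import Mathlib

open CategoryTheory CategoryTheory.Limits Opposite

noncomputable section

namespace SelfSim

universe u

variable {A : Type u} [SmallCategory A]

/-! ### Tensor products of modules with functors -/

/-- The disjoint union `∑ b, Y b × X b`, for a presheaf `Y` and a functor `X` on `A`. -/
abbrev PreTensor (Y : Aᵒᵖ ⥤ Type u) (X : A ⥤ Type u) : Type u :=
  Σ p : (Σ b : A, Y.obj (op b)), X.obj p.1

/-- The relation `(yg, x) ∼ (y, gx)` generating the identifications in `Y ⊗ X`. -/
inductive TensorRel (Y : Aᵒᵖ ⥤ Type u) (X : A ⥤ Type u) :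
    PreTensor Y X → PreTensor Y X → Prop
  | glue {b' b : A} (g : b' ⟶ b) (y : Y.obj (op b)) (x : X.obj b') :
      TensorRel Y X ⟨⟨b', Y.map g.op y⟩, x⟩ ⟨⟨b, y⟩, X.map g x⟩

/-- The set `Y ⊗ X`: the coend of `Y b × X b`, as a quotient of the disjoint union. -/
def Tensor (Y : Aᵒᵖ ⥤ Type u) (X : A ⥤ Type u) : Type u :=
  Quot (TensorRel Y X)

namespace Tensor

/-- The element `y ⊗ x`. -/
def tmul {Y : Aᵒᵖ ⥤ Type u} {X : A ⥤ Type u} {b : A} (y : Y.obj (op b)) (x : X.obj b) :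
    Tensor Y X :=
  Quot.mk _ ⟨⟨b, y⟩, x⟩

theorem tmul_glue {Y : Aᵒᵖ ⥤ Type u} {X : A ⥤ Type u} {b' b : A} (g : b' ⟶ b)
    (y : Y.obj (op b)) (x : X.obj b') :
    (tmul (Y.map g.op y) x : Tensor Y X) = tmul y (X.map g x) :=
  Quot.sound (TensorRel.glue g y x)

/-- Functoriality of `Y ⊗ X` in both variables: `y ⊗ x ↦ α y ⊗ φ x`. -/
def map {Y Y' : Aᵒᵖ ⥤ Type u} {X X' : A ⥤ Type u} (α : Y ⟶ Y') (φ : X ⟶ X') :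
    Tensor Y X → Tensor Y' X' :=
  Quot.lift (fun p => tmul (α.app (op p.1.1) p.1.2) (φ.app p.1.1 p.2)) (by
    rintro _ _ ⟨g, y, x⟩
    have h1 := NatTrans.naturality_apply α g.op y
    have h2 := NatTrans.naturality_apply φ g x
    simp only [h1, h2]
    exact tmul_glue g _ _)

@[simp]
theorem map_tmul {Y Y' : Aᵒᵖ ⥤ Type u} {X X' : A ⥤ Type u} (α : Y ⟶ Y') (φ : X ⟶ X')
    {b : A} (y : Y.obj (op b)) (x : X.obj b) :
    map α φ (tmul y x) = tmul (α.app (op b) y) (φ.app b x) := rfl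

theorem ind {Y : Aᵒᵖ ⥤ Type u} {X : A ⥤ Type u} {P : Tensor Y X → Prop}
    (h : ∀ (b : A) (y : Y.obj (op b)) (x : X.obj b), P (tmul y x)) (t : Tensor Y X) : P t :=
  Quot.ind (fun p => h p.1.1 p.1.2 p.2) t

end Tensor

/-- The functor `- ⊗ X` from presheaves on `A` to sets. -/
def tensorRight (X : A ⥤ Type u) : (Aᵒᵖ ⥤ Type u) ⥤ Type u where
  obj Y := Tensor Y X
  map α := TypeCat.ofHom (Tensor.map α (𝟙 X))
  map_id Y := by
    ext t
    induction t using Tensor.ind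
    simp
  map_comp α β := by
    ext t
    induction t using Tensor.ind
    simp

/-! ### Nondegeneracy, finiteness and equational systems -/

/-- A functor `X : A ⥤ Set` is nondegenerate (componentwise flat) if `- ⊗ X` preserves
finite connected limits. -/
def Nondegenerate (X : A ⥤ Type u) : Prop :=
  ∀ (J : Type) [SmallCategory J] [FinCategory J] [IsConnected J],
    PreservesLimitsOfShape J (tensorRight X)

/-- A functor `X : A ⥤ Top` is nondegenerate if its underlying set-valued functor is
nondegenerate and every map `X f` is closed. -/
def NondegenerateTop (X : A ⥤ TopCat.{u}) : Prop :=
  Nondegenerate (X ⋙ forget TopCat.{u}) ∧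
    ∀ ⦃a b : A⦄ (f : a ⟶ b), IsClosedMap (X.map f)

/-- A module `M` from `A` to itself, i.e. a functor `Aᵒᵖ × A ⥤ Set`, in curried form: the set
`M(b, a)` of sectors `b ⇸ a` is `(M.obj a).obj (op b)`, the presheaf `M(-, a)` is `M.obj a`, and
the functor `M(b, -)` is `M.flip.obj (op b)`. -/
abbrev EndoModule (A : Type u) [SmallCategory A] : Type (u + 1) := A ⥤ Aᵒᵖ ⥤ Type u

/-- A presheaf is finite if its category of elements has only finitely many arrows.
(Mathlib's `Y.Elements` is the opposite of the category with arrows `g : b ⟶ b'` such that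
`y'g = y`, which makes no difference to finiteness.) -/
def FinitePresheaf (Y : Aᵒᵖ ⥤ Type u) : Prop :=
  Finite (Arrow Y.Elements)

/-- `(A, M)` is an equational system if the module `M` is finite and nondegenerate. -/
structure IsEquationalSystem (M : EndoModule A) : Prop where
  finite : ∀ a : A, FinitePresheaf (M.obj a)
  nondegenerate : ∀ b : A, Nondegenerate (M.flip.obj (op b))

/-! ### The endofunctor `M ⊗ -` on functors to `Top`, and its coalgebras -/

/-- The space `Y ⊗ X` for `X : A ⥤ Top`: the coend of the spaces `Y b × X b` (with `Y b`
discrete), i.e. the quotient of the topological disjoint union over all `b` and `y ∈ Y b` of the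
spaces `X b`, with the quotient topology. -/
def topTensor (Y : Aᵒᵖ ⥤ Type u) (X : A ⥤ TopCat.{u}) : TopCat.{u} :=
  letI (p : Σ b : A, Y.obj (op b)) : TopologicalSpace ((X ⋙ forget TopCat.{u}).obj p.1) :=
    (X.obj p.1).str
  @TopCat.of (Tensor Y (X ⋙ forget TopCat.{u}))
    (inferInstanceAs (TopologicalSpace (Quot (TensorRel Y (X ⋙ forget TopCat.{u})))))

/-- The element `y ⊗ x` of the space `Y ⊗ X`. -/
def topTmul {Y : Aᵒᵖ ⥤ Type u} {X : A ⥤ TopCat.{u}} {b : A} (y : Y.obj (op b)) (x : X.obj b) :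
    topTensor Y X :=
  Tensor.tmul (Y := Y) (X := X ⋙ forget TopCat.{u}) y x

theorem continuous_topTmul {Y : Aᵒᵖ ⥤ Type u} {X : A ⥤ TopCat.{u}} {b : A}
    (y : Y.obj (op b)) : Continuous (fun x : X.obj b => (topTmul y x : topTensor Y X)) := by
  let (p : Σ b : A, Y.obj (op b)) : TopologicalSpace ((X ⋙ forget TopCat.{u}).obj p.1) :=
    (X.obj p.1).str
  exact continuous_quot_mk.comp
    (continuous_sigmaMk (σ := fun p : (Σ b : A, Y.obj (op b)) =>
      (X ⋙ forget TopCat.{u}).obj p.1) (i := ⟨b, y⟩))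

theorem continuous_topTensor_dom {Y : Aᵒᵖ ⥤ Type u} {X : A ⥤ TopCat.{u}} {Z : Type*}
    [TopologicalSpace Z] {h : topTensor Y X → Z}
    (H : ∀ (b : A) (y : Y.obj (op b)), Continuous fun x : X.obj b => h (topTmul y x)) :
    Continuous h := by
  let (p : Σ b : A, Y.obj (op b)) : TopologicalSpace ((X ⋙ forget TopCat.{u}).obj p.1) :=
    (X.obj p.1).str
  refine continuous_quot_lift (r := TensorRel Y (X ⋙ forget TopCat.{u})) (f := fun p => h
    (Quot.mk _ p)) (fun a b hab => congrArg h (Quot.sound hab)) ?_ |>.congr ?_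
  · exact continuous_sigma fun p => H p.1 p.2
  · intro t
    induction t using Quot.ind
    rfl

/-- Functoriality of the space `Y ⊗ X` in both variables. -/
def topTensorMap {Y Y' : Aᵒᵖ ⥤ Type u} {X X' : A ⥤ TopCat.{u}} (α : Y ⟶ Y') (φ : X ⟶ X') :
    topTensor Y X ⟶ topTensor Y' X' :=
  TopCat.ofHom (X := topTensor Y X) (Y := topTensor Y' X')
    ⟨Tensor.map α (Functor.whiskerRight φ (forget TopCat.{u})),
    continuous_topTensor_dom fun b y =>
      (continuous_topTmul (α.app (op b) y)).comp (φ.app b).hom.continuous⟩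

theorem topTensorMap_tmul {Y Y' : Aᵒᵖ ⥤ Type u} {X X' : A ⥤ TopCat.{u}} (α : Y ⟶ Y')
    (φ : X ⟶ X') {b : A} (y : Y.obj (op b)) (x : X.obj b) :
    topTensorMap α φ (topTmul y x) = topTmul (α.app (op b) y) (φ.app b x) := rfl

theorem topTensor_hom_ext {Y : Aᵒᵖ ⥤ Type u} {X : A ⥤ TopCat.{u}} {Z : TopCat.{u}}
    {h k : topTensor Y X ⟶ Z}
    (H : ∀ (b : A) (y : Y.obj (op b)) (x : X.obj b), h (topTmul y x) = k (topTmul y x)) :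
    h = k := by
  ext t
  exact Tensor.ind (P := fun t => h t = k t) H t

/-- The endofunctor `M ⊗ -` of the category of functors `A ⥤ Top`:
`(M ⊗ X)(a) = M(-, a) ⊗ X`. -/
def moduleTensor (M : EndoModule A) : (A ⥤ TopCat.{u}) ⥤ (A ⥤ TopCat.{u}) where
  obj X :=
    { obj := fun a => topTensor (M.obj a) X
      map := fun f => topTensorMap (M.map f) (𝟙 X)
      map_id := fun a => topTensor_hom_ext fun b y x => by
        simp [topTensorMap_tmul]
      map_comp := fun f g => topTensor_hom_ext fun b y x => by
        simp [topTensorMap_tmul] }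
  map φ :=
    { app := fun a => topTensorMap (𝟙 (M.obj a)) φ
      naturality := fun a a' f => topTensor_hom_ext fun b y x => by
        simp [topTensorMap_tmul] }
  map_id X := by
    ext1; funext a
    exact topTensor_hom_ext fun b y x => by simp [topTensorMap_tmul]
  map_comp φ φ' := by
    ext1; funext a
    exact topTensor_hom_ext fun b y x => by simp [topTensorMap_tmul]

/-- The category of `M`-coalgebras in `Top`: nondegenerate functors `X : A ⥤ Top` equipped with
a natural transformation `X ⟶ M ⊗ X`. As nondegenerate functors form a full subcategory, these
are the coalgebras for the restriction of `M ⊗ -` to nondegenerate functors. -/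
abbrev CoalgebraTop (M : EndoModule A) : Type (u + 1) :=
  ObjectProperty.FullSubcategory
    (fun C : Endofunctor.Coalgebra (moduleTensor M) => NondegenerateTop C.V)

/-- A universal solution of `(A, M)` in `Top` is a terminal `M`-coalgebra in `Top`. -/
def IsUniversalSolution (M : EndoModule A) (C : CoalgebraTop M) : Prop :=
  Nonempty (IsTerminal C)

/-! ### Barycentric subdivision

The category of the nonempty finite totally ordered sets `[n] = {0, …, n}` and their
order-preserving injections is Mathlib's `SemiSimplexCategory`; `[n]` is `Fin (n.len + 1)`. -/

/-- Chains `∅ ⊂ Q(0) ⊂ ⋯ ⊂ Q(n) ⊆ [m]` of subsets of `[m]`. -/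
@[ext]
structure SubsetChain (n m : ℕ) : Type where
  set : Fin (n + 1) → Finset (Fin (m + 1))
  empty_ssubset : ∅ ⊂ set 0
  strictMono : StrictMono set

namespace SubsetChain

theorem nonempty {n m : ℕ} (Q : SubsetChain n m) (j : Fin (n + 1)) : (Q.set j).Nonempty :=
  (Finset.empty_ssubset.1 Q.empty_ssubset).mono (Q.strictMono.monotone (Fin.zero_le j))

/-- The chain `fQ`: direct images under `f : [m] ⟶ [m']`. -/
def image {n m m' : ℕ} (f : Fin (m + 1) ↪o Fin (m' + 1)) (Q : SubsetChain n m) :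
    SubsetChain n m' where
  set j := (Q.set j).map f.toEmbedding
  empty_ssubset := Finset.empty_ssubset.2 ((Q.nonempty 0).map)
  strictMono := fun _ _ h => Finset.map_ssubset_map.2 (Q.strictMono h)

/-- The chain `Qg`: the subchain picked out by `g : [n'] ⟶ [n]`. -/
def restrict {n' n m : ℕ} (g : Fin (n' + 1) ↪o Fin (n + 1)) (Q : SubsetChain n m) :
    SubsetChain n' m where
  set j := Q.set (g j)
  empty_ssubset := Finset.empty_ssubset.2 (Q.nonempty _)
  strictMono := Q.strictMono.comp g.strictMono

end SubsetChain

open SemiSimplexCategory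

/-- The module of barycentric subdivision: `M([n], [m])` is the set of chains
`∅ ⊂ Q(0) ⊂ ⋯ ⊂ Q(n) ⊆ [m]`. -/
def baryModule : EndoModule SemiSimplexCategory where
  obj m :=
    { obj := fun n => SubsetChain n.unop.len m.len
      map := fun g => TypeCat.ofHom (SubsetChain.restrict (homEquiv g.unop))
      map_id := fun n => rfl
      map_comp := fun g g' => by
        ext Q
        simp [SubsetChain.restrict] }
  map f :=
    { app := fun n => TypeCat.ofHom (SubsetChain.image (homEquiv f))
      naturality := fun n n' g => rfl }
  map_id m := by
    ext n Q
    simp [SubsetChain.image]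
  map_comp f f' := by
    ext n Q
    simp [SubsetChain.image, Finset.map_map]

/-- The standard topological simplex functor, `[n] ↦ Δⁿ = stdSimplex ℝ (Fin (n + 1))`; on maps
it is the affine extension of the map of vertices. -/
def simplexFunctor : SemiSimplexCategory ⥤ TopCat.{0} :=
  SemiSimplexCategory.toSimplexCategory ⋙ SimplexCategory.toTop₀

/-- The barycenter `(1 / |S|) ∑_{i ∈ S} eᵢ` of the face of a simplex spanned by the vertices
in `S`. -/
def faceBarycenter {m : ℕ} (S : Finset (Fin (m + 1))) : Fin (m + 1) → ℝ :=
  (S.card : ℝ)⁻¹ • ∑ i ∈ S, Pi.single i (1 : ℝ)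

theorem faceBarycenter_mem {m : ℕ} {S : Finset (Fin (m + 1))} (hS : S.Nonempty) :
    faceBarycenter S ∈ stdSimplex ℝ (Fin (m + 1)) := by
  have hc : (S.card : ℝ) ≠ 0 := by exact_mod_cast hS.card_ne_zero
  rw [faceBarycenter, Finset.smul_sum]
  refine (convex_stdSimplex ℝ _).sum_mem (fun _ _ => by positivity) ?_
    (fun i _ => single_mem_stdSimplex ℝ i)
  simp [hc]

/-- The map `ψ_Q : Δⁿ → Δᵐ` for a chain `Q`: the restriction of the affine map sending the
vertex `e_j` to the barycenter of the face of `Δᵐ` spanned by `Q(j)`. -/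
def baryMap {n m : ℕ} (Q : SubsetChain n m) (t : stdSimplex ℝ (Fin (n + 1))) :
    stdSimplex ℝ (Fin (m + 1)) :=
  ⟨∑ j, t j • faceBarycenter (Q.set j),
    (convex_stdSimplex ℝ _).sum_mem (fun j _ => t.2.1 j) t.2.2
      (fun j _ => faceBarycenter_mem (Q.nonempty j))⟩

theorem continuous_baryMap {n m : ℕ} (Q : SubsetChain n m) : Continuous (baryMap Q) := by
  refine Continuous.subtype_mk (continuous_finsetSum _ fun j _ => ?_) _
  exact ((continuous_apply j).comp continuous_subtype_val).smul continuous_const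

theorem baryMap_image {n m m' : ℕ} (f : Fin (m + 1) ↪o Fin (m' + 1)) (Q : SubsetChain n m)
    (t : stdSimplex ℝ (Fin (n + 1))) :
    baryMap (Q.image f) t = stdSimplex.map f (baryMap Q t) := by
  apply Subtype.ext
  change _ = FunOnFinite.linearMap ℝ ℝ f (∑ j, t j • faceBarycenter (Q.set j))
  simp only [baryMap, SubsetChain.image, faceBarycenter, map_sum, map_smul,
    FunOnFinite.linearMap_piSingle, Finset.sum_map, Finset.card_map]
  rfl

theorem baryMap_restrict {n' n m : ℕ} (g : Fin (n' + 1) ↪o Fin (n + 1)) (Q : SubsetChain n m)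
    (t : stdSimplex ℝ (Fin (n' + 1))) :
    baryMap (Q.restrict g) t = baryMap Q (stdSimplex.map g t) := by
  apply Subtype.ext
  simp only [baryMap, SubsetChain.restrict, stdSimplex.map_coe,
    FunOnFinite.linearMap_apply_apply, Finset.sum_smul]
  rw [← Finset.sum_fiberwise Finset.univ g]
  refine Finset.sum_congr rfl fun j _ => Finset.sum_congr rfl fun i hi => ?_
  rw [(Finset.mem_filter.1 hi).2]

/-- The natural transformation `ψ : M ⊗ Δ• ⟶ Δ•` of barycentric subdivision, determined by
`ψ (Q ⊗ t) = ψ_Q t`. -/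
def baryAlgebra : (moduleTensor baryModule).obj simplexFunctor ⟶ simplexFunctor where
  app m := TopCat.ofHom (X := topTensor (baryModule.obj m) simplexFunctor)
    (Y := simplexFunctor.obj m)
    ⟨Quot.lift (fun p => baryMap (n := p.1.1.len) (m := m.len) p.1.2 p.2) (by
        rintro _ _ ⟨g, Q, t⟩
        exact baryMap_restrict (homEquiv g) Q t),
      continuous_topTensor_dom (X := simplexFunctor) fun n Q => continuous_baryMap Q⟩
  naturality m m' f := topTensor_hom_ext fun n Q t => baryMap_image (homEquiv f) Q t

theorem baryAlgebra_tmul {n m : SemiSimplexCategory} (Q : SubsetChain n.len m.len)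
    (t : stdSimplex ℝ (Fin (n.len + 1))) :
    baryAlgebra.app m (topTmul (Y := baryModule.obj m) (X := simplexFunctor) (b := n) Q t) =
      baryMap Q t := rfl

end SelfSim

end

/-!
# Barycentric subdivision and the topological simplices

On the semi-simplex category, a functor `X` is a coproduct of representables as soon as each
element is carried by a smallest face, naturally (`nondegenerate_of_supp`), and coproducts of representables
are nondegenerate because coproducts commute with connected limits in sets
(`nondegenerate_of_generators`). For `M([n], -)` the smallest face is the largest member of a chain,
for `Δ•` it is the set of vertices with nonzero coordinate.

The map `ψ` is bijective because a nonnegative function on `[m]` is uniquely a positive combination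
of indicator functions of a chain of subsets, namely of its superlevel sets (`exists_chainSum_eq`,
`mem_range_set_iff`, `chainSum_injective`). It is a homeomorphism by compactness.

For terminality, let `ξ : X ⟶ M ⊗ X` be a coalgebra. Coalgebra maps to `(Δ•, ψ⁻¹)` are the continuous
fixed points of the operator `θ ↦ ψ ∘ (M ⊗ θ) ∘ ξ`, which makes sense for natural transformations
`θ` that are merely maps of sets. In dimensions at most `N` each `ψ_Q` contracts the `ℓ¹` distance
by the factor `1 - 1 / (N + 1)` (`dist₁_baryMap_le`), and a chain of length `n` in `[m]` has `n ≤ m`,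
so the operator is a contraction in dimensions at most `N`. Fixed points are therefore unique. One
exists by iteration, from the transformation that sends an element to the barycenter of its smallest
carrying face; such faces exist and are natural because `X` is nondegenerate (`supp_map`,
`supp_nonempty`).

The starting transformation need not be continuous, but the fixed point is: the maps `Q ⊗ -` into `M ⊗ X`
are closed and finite in number (`isClosedMap_topTmul`), so that a bound `ε` on the oscillation of a
fixed point at all points of dimension at most `N` improves to the bound `(1 - 1 / (N + 1)) ε`
(`SetTrans.eventually_dist₁_le_of_step_eq`).
-/

open CategoryTheory CategoryTheory.Limits Opposite

noncomputable section

namespace SelfSim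

universe u

/-! ### Nondegenerate functors -/

section General

variable {A : Type u} [SmallCategory A]

/-- Elements of a nondegenerate functor that agree in `X c` come from a common element, over a
commutative square. This is preservation of the pullback of `yoneda f` and `yoneda f'` by `- ⊗ X`,
read through the isomorphism of `yoneda a ⊗ X` with `X a`; it is the only consequence of
nondegeneracy that is needed. -/
theorem Nondegenerate.exists_span {X : A ⥤ Type u} (hX : Nondegenerate X) {a a' c : A}
    (f : a ⟶ c) (f' : a' ⟶ c) (x : X.obj a) (x' : X.obj a') (h : X.map f x = X.map f' x') :
    ∃ (d : A) (g : d ⟶ a) (g' : d ⟶ a') (z : X.obj d),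
      g ≫ f = g' ≫ f' ∧ X.map g z = x ∧ X.map g' z = x' := by
  have := hX WalkingCospan
  have hP := (IsPullback.of_hasPullback (yoneda.map f) (yoneda.map f')).map (tensorRight X)
  obtain ⟨t, ht, ht'⟩ := Types.exists_of_isPullback hP
    (Tensor.tmul (Y := yoneda.obj a) (𝟙 a) x) (Tensor.tmul (Y := yoneda.obj a') (𝟙 a') x') (by
      have e := Tensor.tmul_glue (Y := yoneda.obj c) (X := X) f (𝟙 c) x
      have e' := Tensor.tmul_glue (Y := yoneda.obj c) (X := X) f' (𝟙 c) x'
      rw [h, ← e'] at e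
      change Tensor.tmul (Y := yoneda.obj c) (𝟙 a ≫ f) x =
        Tensor.tmul (Y := yoneda.obj c) (𝟙 a' ≫ f') x'
      simpa using e)
  -- The co-Yoneda isomorphism `y a ⊗ X ≅ X a`.
  let ev (a : A) : Tensor (yoneda.obj a) X → X.obj a :=
    Quot.lift (fun p => X.map (show p.1.1 ⟶ a from p.1.2) p.2) (by
      rintro _ _ ⟨g, y, x⟩
      simp)
  have ev_one (a : A) (x : X.obj a) : ev a (Tensor.tmul (Y := yoneda.obj a) (𝟙 a) x) = x := by
    simp [ev, Tensor.tmul]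
  induction t using Tensor.ind with | h d p z
  refine ⟨d, (pullback.fst (yoneda.map f) (yoneda.map f')).app (op d) p,
    (pullback.snd (yoneda.map f) (yoneda.map f')).app (op d) p, z, ?_, ?_, ?_⟩
  · exact types_congr_hom (NatTrans.congr_app
      (pullback.condition (f := yoneda.map f) (g := yoneda.map f')) (op d)) p
  · have := congrArg (ev a) ht
    rwa [ev_one] at this
  · have := congrArg (ev a') ht'
    rwa [ev_one] at this

/-- Spans compose, so over a nondegenerate functor two representatives of the same element of
`Y ⊗ X` are related by a single span. -/
theorem Tensor.exists_span_of_eq {X : A ⥤ Type u} (hX : Nondegenerate X) {Y : Aᵒᵖ ⥤ Type u}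
    {b b' : A} {y : Y.obj (op b)} {y' : Y.obj (op b')} {x : X.obj b} {x' : X.obj b'}
    (h : (Tensor.tmul y x : Tensor Y X) = Tensor.tmul y' x') :
    ∃ (c : A) (f : c ⟶ b) (f' : c ⟶ b') (z : X.obj c),
      Y.map f.op y = Y.map f'.op y' ∧ X.map f z = x ∧ X.map f' z = x' := by
  let R : PreTensor Y X → PreTensor Y X → Prop := fun p q =>
    ∃ (c : A) (f : c ⟶ p.1.1) (f' : c ⟶ q.1.1) (z : X.obj c),
      Y.map f.op p.1.2 = Y.map f'.op q.1.2 ∧ X.map f z = p.2 ∧ X.map f' z = q.2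
  suffices H : ∀ p q, Relation.EqvGen (TensorRel Y X) p q → R p q from
    H ⟨⟨b, y⟩, x⟩ ⟨⟨b', y'⟩, x'⟩ (Quot.eqvGen_exact h)
  intro p q hpq
  induction hpq with
  | rel _ _ h =>
    obtain ⟨g, y, x⟩ := h
    exact ⟨_, 𝟙 _, g, x, by simp, by simp, rfl⟩
  | refl p => exact ⟨_, 𝟙 _, 𝟙 _, p.2, rfl, by simp, by simp⟩
  | symm _ _ _ ih =>
    obtain ⟨c, f, f', z, h1, h2, h3⟩ := ih
    exact ⟨c, f', f, z, h1.symm, h3, h2⟩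
  | trans p q r _ _ ih ih' =>
    obtain ⟨c, f, f', z, h1, h2, h3⟩ := ih
    obtain ⟨c', k, k', z', h1', h2', h3'⟩ := ih'
    obtain ⟨d, g, g', w, e1, e2, e3⟩ := hX.exists_span f' k z z' (h3.trans h2'.symm)
    refine ⟨d, g ≫ f, g' ≫ k', w, ?_, ?_, ?_⟩
    · simp only [op_comp, Functor.map_comp, types_comp_apply, h1, ← h1']
      simp only [← types_comp_apply, ← Functor.map_comp, ← op_comp, e1]
    · simp [e2, h2]
    · simp [e3, h3']

/-- The functor `Y ↦ ∑ i, Y (a i)` on presheaves. -/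
def sigmaEval {I : Type u} (a : I → A) : (Aᵒᵖ ⥤ Type u) ⥤ Type u where
  obj Y := Σ i, Y.obj (op (a i))
  map α := TypeCat.ofHom fun p => ⟨p.1, α.app _ p.2⟩

/-- In the category of sets, coproducts commute with connected limits: the indices occurring in a
section of a connected diagram of coproducts are all equal. -/
theorem preservesLimitsOfShape_sigmaEval {I : Type u} (a : I → A) (J : Type) [SmallCategory J]
    [IsConnected J] : PreservesLimitsOfShape J (sigmaEval a) where
  preservesLimit {K} := ⟨fun {c} hc => by
    rw [Types.isLimit_iff]
    intro s hs
    -- A section of a connected diagram stays in a single summand `i`.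
    have hconst : ∀ j j', (s j).1 = (s j').1 := by
      refine constant_of_preserves_morphisms (fun j => (s j).1) fun j j' f => ?_
      rw [← hs f]
      rfl
    obtain ⟨j₀⟩ := (inferInstance : Nonempty J)
    obtain ⟨i, hi⟩ : ∃ i, ∀ j, (s j).1 = i := ⟨(s j₀).1, fun j => hconst j j₀⟩
    have hs' : ∀ j, ∃ y : (K.obj j).obj (op (a i)), s j = ⟨i, y⟩ := by
      intro j
      obtain rfl := hi j
      exact ⟨(s j).2, rfl⟩
    choose y hy using hs'
    have hlim := (Types.isLimit_iff _).1
      ⟨isLimitOfPreserves ((evaluation Aᵒᵖ (Type u)).obj (op (a i))) hc⟩ y (by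
        intro j j' f
        have := hs f
        rw [hy, hy] at this
        exact eq_of_heq (Sigma.mk.inj this).2)
    obtain ⟨x, hx, hx'⟩ := hlim
    refine ⟨⟨i, x⟩, fun j => ?_, ?_⟩
    · rw [hy]
      exact congrArg (Sigma.mk i) (hx j)
    · rintro ⟨i', x'⟩ h
      have h0 := h j₀
      rw [hy] at h0
      obtain rfl : i' = i := (Sigma.mk.inj h0).1
      refine congrArg (Sigma.mk i') (hx' x' fun j => ?_)
      have hj := h j
      rw [hy] at hj
      exact eq_of_heq (Sigma.mk.inj hj).2⟩

/-- A functor that is freely generated by elements `x i`, i.e. a coproduct of representables, is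
nondegenerate: `Y ⊗ X` is then `∑ i, Y (a i)`. -/
theorem nondegenerate_of_generators (X : A ⥤ Type u) {I : Type u} (a : I → A)
    (x : ∀ i, X.obj (a i))
    (hx : ∀ b, Function.Bijective fun p : Σ i, a i ⟶ b => X.map p.2 (x p.1)) :
    Nondegenerate X := by
  intro J _ _ _
  let F (Y : Aᵒᵖ ⥤ Type u) : (Σ i, Y.obj (op (a i))) → Tensor Y X :=
    fun p => Tensor.tmul p.2 (x p.1)
  have hF : ∀ Y, Function.Bijective (F Y) := by
    intro Y
    -- `e b` presents an element of `X b` by a generator and an arrow out of its index.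
    let e (b : A) := Equiv.ofBijective _ (hx b)
    have he (b : A) (p : Σ i, a i ⟶ b) : (e b).symm (X.map p.2 (x p.1)) = p :=
      (e b).symm_apply_apply p
    let pull {b : A} (p : Σ i, a i ⟶ b) (y : Y.obj (op b)) : Σ i, Y.obj (op (a i)) :=
      ⟨p.1, Y.map p.2.op y⟩
    let G : Tensor Y X → Σ i, Y.obj (op (a i)) :=
      Quot.lift (fun p => pull ((e _).symm p.2) p.1.2) (by
        rintro _ _ ⟨g, y, t⟩
        obtain ⟨⟨i, f⟩, rfl⟩ := (hx _).2 t
        have h2 := he _ ⟨i, f ≫ g⟩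
        simp only [Functor.map_comp, types_comp_apply] at h2
        change pull ((e _).symm (X.map f (x i))) _ =
          pull ((e _).symm (X.map g (X.map f (x i)))) _
        rw [he _ ⟨i, f⟩, h2]
        simp [pull])
    constructor
    · refine Function.LeftInverse.injective (g := G) fun ⟨i, y⟩ => ?_
      have h1 := he _ ⟨i, 𝟙 _⟩
      simp only [CategoryTheory.Functor.map_id, types_id_apply] at h1
      change pull ((e _).symm (x i)) y = _
      rw [h1]
      simp [pull]
    · intro t
      induction t using Tensor.ind with | h b y t
      obtain ⟨⟨i, f⟩, rfl⟩ := (hx _).2 t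
      exact ⟨⟨i, Y.map f.op y⟩, Tensor.tmul_glue f y (x i)⟩
  have iso : sigmaEval a ≅ tensorRight X :=
    NatIso.ofComponents (fun Y => (Equiv.ofBijective _ (hF Y)).toIso) (fun α => by
      ext p
      rfl)
  have := preservesLimitsOfShape_sigmaEval a J
  exact preservesLimitsOfShape_of_natIso iso

end General

open SemiSimplexCategory

/-! ### Faces, and the criterion for nondegeneracy on the semi-simplex category -/

/-- The image of a map `f : [k] ⟶ [m]`, a face of `[m]`. -/
def face {k m : SemiSimplexCategory} (f : k ⟶ m) : Finset (Fin (m.len + 1)) :=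
  Finset.univ.map (homEquiv f).toEmbedding

theorem mem_face {k m : SemiSimplexCategory} {f : k ⟶ m} {i : Fin (m.len + 1)} :
    i ∈ face f ↔ ∃ j, homEquiv f j = i := by
  simp [face]

theorem face_comp {k l m : SemiSimplexCategory} (f : k ⟶ l) (g : l ⟶ m) :
    face (f ≫ g) = (face f).map (homEquiv g).toEmbedding := by
  ext i
  simp [mem_face]

theorem face_comp_subset {k l m : SemiSimplexCategory} (f : k ⟶ l) (g : l ⟶ m) :
    face (f ≫ g) ⊆ face g := by
  intro i hi
  obtain ⟨j, rfl⟩ := mem_face.1 hi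
  exact mem_face.2 ⟨homEquiv f j, by simp⟩

theorem card_face {k m : SemiSimplexCategory} (f : k ⟶ m) : (face f).card = k.len + 1 := by
  simp [face]

/-- Every nonempty subset of `[m]` is a face: list its elements in increasing order. -/
theorem exists_face_eq {m : SemiSimplexCategory} {T : Finset (Fin (m.len + 1))}
    (hT : T.Nonempty) : ∃ (k : SemiSimplexCategory) (f : k ⟶ m), face f = T := by
  have hc : T.card = T.card - 1 + 1 := by have := hT.card_pos; omega
  refine ⟨⟨T.card - 1⟩, homEquiv.symm (T.orderEmbOfFin hc), ?_⟩
  simp [face]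

/-- A map into `[m]` is determined, together with its domain, by its image. -/
theorem sigma_hom_ext {m k k' : SemiSimplexCategory} {f : k ⟶ m} {f' : k' ⟶ m}
    (h : face f = face f') : (⟨k, f⟩ : Σ k, k ⟶ m) = ⟨k', f'⟩ := by
  obtain rfl : k = k' := by
    have := congrArg Finset.card h
    rw [card_face, card_face] at this
    ext
    omega
  congr 1
  ext1
  have e := fun g : k ⟶ m => fun (hg : face g = face f) =>
    Finset.orderEmbOfFin_unique' (card_face f) (f := homEquiv g)
      (fun x => by rw [← hg]; exact mem_face.2 ⟨x, rfl⟩)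
  rw [e f rfl, e f' h.symm]

/-- A set-valued functor in which every element `x` has a smallest face `supp x` carrying it is a
coproduct of representables, generated by the elements of full support. -/
theorem nondegenerate_of_supp (X : SemiSimplexCategory ⥤ Type)
    (supp : ∀ {n : SemiSimplexCategory}, X.obj n → Finset (Fin (n.len + 1)))
    (nonempty : ∀ {n} (x : X.obj n), (supp x).Nonempty)
    (map_supp : ∀ {n m} (f : n ⟶ m) (x : X.obj n),
      supp (X.map f x) = (supp x).map (homEquiv f).toEmbedding)
    (inj : ∀ {n m} (f : n ⟶ m), Function.Injective (X.map f))
    (lift : ∀ {n m} (f : n ⟶ m) (x : X.obj m), supp x = face f → ∃ z, X.map f z = x) :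
    Nondegenerate X := by
  refine nondegenerate_of_generators X
    (I := Σ n : SemiSimplexCategory, {x : X.obj n // supp x = Finset.univ})
    (fun i => i.1) (fun i => i.2.1) fun b => ⟨?_, ?_⟩
  · rintro ⟨⟨n, x, hx⟩, f⟩ ⟨⟨n', x', hx'⟩, f'⟩ h
    dsimp only at f f' h
    have hf : face f = face f' := by
      have h1 := map_supp f x
      have h2 := map_supp f' x'
      rw [hx] at h1
      rw [hx'] at h2
      rw [face, face, ← h1, ← h2, h]
    obtain ⟨rfl, hf⟩ := Sigma.mk.inj (sigma_hom_ext hf)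
    obtain rfl := eq_of_heq hf
    obtain rfl := inj f h
    rfl
  · intro x
    obtain ⟨k, f, hf⟩ := exists_face_eq (nonempty x)
    obtain ⟨z, rfl⟩ := lift f x hf.symm
    refine ⟨⟨⟨k, z, ?_⟩, f⟩, rfl⟩
    rw [map_supp, face] at hf
    exact (Finset.map_injective _ hf).symm

/-! ### The module of barycentric subdivision -/

theorem SubsetChain.subset_last {n m : ℕ} (Q : SubsetChain n m) (j : Fin (n + 1)) :
    Q.set j ⊆ Q.set (Fin.last n) :=
  Q.strictMono.monotone (Fin.le_last j)

theorem SubsetChain.len_le {n m : ℕ} (Q : SubsetChain n m) : n ≤ m := by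
  have h : ∀ j : Fin (n + 1), (j : ℕ) + 1 ≤ (Q.set j).card := by
    intro j
    induction j using Fin.induction with
    | zero => exact (Q.nonempty 0).card_pos
    | succ j ih =>
      have := Finset.card_lt_card (Q.strictMono (Fin.castSucc_lt_succ (i := j)))
      simp only [Fin.val_castSucc, Fin.val_succ] at *
      omega
  have h1 := h (Fin.last n)
  have h2 := Finset.card_le_univ (Q.set (Fin.last n))
  simp only [Fin.val_last, Fintype.card_fin] at h1 h2
  omega

instance (n m : ℕ) : Finite (SubsetChain n m) :=
  Finite.of_injective SubsetChain.set fun _ _ h => SubsetChain.ext h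

/-- The smallest face carrying a chain is its largest member. -/
theorem nondegenerate_baryModule (n : SemiSimplexCategory) :
    Nondegenerate (baryModule.flip.obj (op n)) := by
  refine nondegenerate_of_supp _
    (fun {m} (Q : SubsetChain n.len m.len) => Q.set (Fin.last _))
    (fun {m} (Q : SubsetChain n.len m.len) => Q.nonempty _)
    (fun f (Q : SubsetChain n.len _) => rfl) ?_ ?_
  · intro m m' f (Q : SubsetChain n.len m.len) (Q' : SubsetChain n.len m.len) h
    change SubsetChain.image (homEquiv f) Q = SubsetChain.image (homEquiv f) Q' at h
    refine SubsetChain.ext (funext fun j => ?_)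
    exact Finset.map_injective _ (congrFun (congrArg SubsetChain.set h) j)
  · intro m m' f (Q : SubsetChain n.len m'.len) hQ
    have hsub (j) : ∃ S : Finset (Fin (m.len + 1)),
        S.map (homEquiv f).toEmbedding = Q.set j := by
      have h := Q.subset_last j
      rw [hQ, face, Finset.subset_map_iff] at h
      obtain ⟨S, -, hS⟩ := h
      exact ⟨S, hS.symm⟩
    choose S hS using hsub
    refine ⟨(⟨S, ?_, ?_⟩ : SubsetChain n.len m.len), SubsetChain.ext (funext hS)⟩
    · have := Q.nonempty 0
      rw [← hS, Finset.map_nonempty] at this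
      exact Finset.empty_ssubset.2 this
    · intro j j' h
      have := Q.strictMono h
      rwa [← hS, ← hS, Finset.map_ssubset_map] at this

/-- Only finitely many chains of subsets of `[m]` exist, over all lengths. -/
instance finite_sigma_subsetChain (m : ℕ) :
    Finite (Σ n : SemiSimplexCategory, SubsetChain n.len m) := by
  refine Finite.of_injective (β := Σ n : Fin (m + 1), SubsetChain n m)
    (fun Q => ⟨⟨Q.1.len, Nat.lt_succ_of_le (SubsetChain.len_le Q.2)⟩, Q.2⟩) ?_
  rintro ⟨⟨n⟩, Q⟩ ⟨⟨n'⟩, Q'⟩ h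
  obtain ⟨h1, h2⟩ := Sigma.mk.inj h
  obtain rfl : n = n' := congrArg Fin.val h1
  obtain rfl : Q = Q' := eq_of_heq h2
  rfl

instance finite_hom (n n' : SemiSimplexCategory) : Finite (n ⟶ n') :=
  Finite.of_injective (fun f => (homEquiv f : Fin (n.len + 1) → Fin (n'.len + 1)))
    fun _ _ h => hom_ext (DFunLike.coe_injective h)

theorem finitePresheaf_baryModule (m : SemiSimplexCategory) :
    FinitePresheaf (baryModule.obj m) := by
  have : Finite (baryModule.obj m).Elements :=
    Finite.of_injective (β := Σ n : SemiSimplexCategory, SubsetChain n.len m.len)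
      (fun Q => ⟨Q.1.unop, Q.2⟩) (by
        rintro ⟨⟨n⟩, Q⟩ ⟨⟨n'⟩, Q'⟩ h
        cases h
        rfl)
  have (P Q : (baryModule.obj m).Elements) : Finite (P ⟶ Q) :=
    Finite.of_injective (β := Q.1.unop ⟶ P.1.unop) (fun f => f.1.unop)
      fun _ _ h => Subtype.ext (Quiver.Hom.unop_inj h)
  exact Finite.of_injective
    (β := Σ P : (baryModule.obj m).Elements × (baryModule.obj m).Elements, P.1 ⟶ P.2)
    (fun f => ⟨⟨f.left, f.right⟩, f.hom⟩) (by
      rintro ⟨a, b, f⟩ ⟨a', b', f'⟩ h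
      obtain ⟨h1, h2⟩ := Sigma.mk.inj h
      obtain ⟨rfl, rfl⟩ := Prod.mk.inj h1
      obtain rfl := eq_of_heq h2
      rfl)

theorem isEquationalSystem_baryModule : IsEquationalSystem baryModule :=
  ⟨finitePresheaf_baryModule, nondegenerate_baryModule⟩

/-! ### The simplex functor -/

section Simplex

variable {n m : ℕ} (f : Fin (n + 1) ↪o Fin (m + 1)) (t : stdSimplex ℝ (Fin (n + 1)))

theorem stdSimplex_map_apply (j : Fin (n + 1)) : stdSimplex.map f t (f j) = t j := by
  rw [stdSimplex.map_coe, FunOnFinite.linearMap_apply_apply]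
  simp [Finset.sum_filter]

theorem stdSimplex_map_of_notMem {i : Fin (m + 1)} (hi : ∀ j, f j ≠ i) :
    stdSimplex.map f t i = 0 := by
  rw [stdSimplex.map_coe, FunOnFinite.linearMap_apply_apply]
  simp [hi]

/-- A point supported on the image of `f` lies in the corresponding face. -/
theorem exists_stdSimplex_map_eq (s : stdSimplex ℝ (Fin (m + 1)))
    (hs : ∀ i, s i ≠ 0 → ∃ j, f j = i) : ∃ t, stdSimplex.map f t = s := by
  have hsum : ∑ j, s (f j) = 1 := by
    rw [← stdSimplex.sum_eq_one s]
    refine (Finset.sum_map Finset.univ f.toEmbedding s).symm.trans ?_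
    refine Finset.sum_subset (Finset.subset_univ _) fun i _ hi => ?_
    by_contra h
    obtain ⟨j, rfl⟩ := hs i h
    exact hi (Finset.mem_map_of_mem f.toEmbedding (Finset.mem_univ j))
  refine ⟨⟨fun j => s (f j), fun j => s.2.1 _, hsum⟩, ?_⟩
  ext i
  by_cases h : ∃ j, f j = i
  · obtain ⟨j, rfl⟩ := h
    exact stdSimplex_map_apply f _ j
  · rw [stdSimplex_map_of_notMem f _ (not_exists.1 h)]
    by_contra hne
    exact h (hs i (Ne.symm hne))

/-- The vertices of the smallest face of the simplex containing `t`. -/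
def carrier (t : stdSimplex ℝ (Fin (n + 1))) : Finset (Fin (n + 1)) :=
  Finset.univ.filter fun i => t i ≠ 0

theorem mem_carrier {t : stdSimplex ℝ (Fin (n + 1))} {i : Fin (n + 1)} :
    i ∈ carrier t ↔ t i ≠ 0 := by
  simp [carrier]

theorem carrier_nonempty : (carrier t).Nonempty := by
  by_contra h
  have h0 : ∀ i, t i = 0 := by
    intro i
    by_contra hi
    exact h ⟨i, mem_carrier.2 hi⟩
  have := stdSimplex.sum_eq_one t
  simp [h0] at this

theorem carrier_map : carrier (stdSimplex.map f t) = (carrier t).map f.toEmbedding := by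
  ext i
  rw [mem_carrier, Finset.mem_map]
  constructor
  · intro hi
    by_cases h : ∃ j, f j = i
    · obtain ⟨j, rfl⟩ := h
      rw [stdSimplex_map_apply] at hi
      exact ⟨j, mem_carrier.2 hi, rfl⟩
    · exact absurd (stdSimplex_map_of_notMem f t (not_exists.1 h)) hi
  · rintro ⟨j, hj, rfl⟩
    exact (stdSimplex_map_apply f t j).trans_ne (mem_carrier.1 hj)

theorem stdSimplex_map_injective : Function.Injective (stdSimplex.map (S := ℝ) f) := by
  intro t t' h
  ext j
  rw [← stdSimplex_map_apply f t j, h, stdSimplex_map_apply]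

end Simplex

theorem nondegenerate_simplexFunctor : NondegenerateTop simplexFunctor := by
  constructor
  · refine nondegenerate_of_supp _
      (fun {n} (t : stdSimplex ℝ (Fin (n.len + 1))) => carrier t)
      (fun {n} (t : stdSimplex ℝ (Fin (n.len + 1))) => carrier_nonempty t)
      (fun {n m} f (t : stdSimplex ℝ (Fin (n.len + 1))) => carrier_map (homEquiv f) t)
      (fun f => stdSimplex_map_injective (homEquiv f)) ?_
    intro n m f (t : stdSimplex ℝ (Fin (m.len + 1))) ht
    refine exists_stdSimplex_map_eq (homEquiv f) t fun i hi => mem_face.1 ?_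
    rw [← ht]
    exact mem_carrier.2 hi
  · intro a b f
    have h1 : CompactSpace (simplexFunctor.obj a) :=
      inferInstanceAs (CompactSpace (stdSimplex ℝ (Fin (a.len + 1))))
    have h2 : T2Space (simplexFunctor.obj b) :=
      inferInstanceAs (T2Space (stdSimplex ℝ (Fin (b.len + 1))))
    exact (simplexFunctor.map f).hom.continuous.isClosedMap

/-! ### Layer-cake decompositions along chains -/

section LayerCake

variable {n m : ℕ}

/-- The linear combination `∑ j, c j • 1_{Q j}` of the indicator functions of a chain. -/
def chainSum (Q : SubsetChain n m) (c : Fin (n + 1) → ℝ) (i : Fin (m + 1)) : ℝ :=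
  ∑ j, if i ∈ Q.set j then c j else 0

/-- A nonempty set contained in no member of the chain before `Q j` has an element missing from all
of those at once, since it is enough to avoid the largest of them. -/
theorem SubsetChain.exists_mem_forall_notMem (Q : SubsetChain n m) {j : Fin (n + 1)}
    {S : Finset (Fin (m + 1))} (hS : S.Nonempty) (h : ∀ l < j, ¬ S ⊆ Q.set l) :
    ∃ i ∈ S, ∀ l < j, i ∉ Q.set l := by
  induction j using Fin.cases with
  | zero =>
    obtain ⟨i, hi⟩ := hS
    exact ⟨i, hi, fun l hl => absurd hl (Fin.not_lt_zero l)⟩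
  | succ j =>
    obtain ⟨i, hi, hi'⟩ := Finset.not_subset.1 (h j.castSucc Fin.castSucc_lt_succ)
    refine ⟨i, hi, fun l hl hil => hi' (Q.strictMono.monotone ?_ hil)⟩
    rw [Fin.lt_def, Fin.val_succ] at hl
    rw [Fin.le_def, Fin.val_castSucc]
    omega

/-- If the coefficients are positive, the members of the chain are recovered from the function
`p = ∑ j, c j • 1_{Q j}`: they are the nonempty superlevel sets `{i | v < p i}` with `0 ≤ v`. -/
theorem mem_range_set_iff (Q : SubsetChain n m) {c : Fin (n + 1) → ℝ} (hc : ∀ j, 0 < c j)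
    (S : Finset (Fin (m + 1))) :
    S ∈ Set.range Q.set ↔ S.Nonempty ∧ (∀ i ∈ S, 0 < chainSum Q c i) ∧
      ∀ i ∈ S, ∀ i' ∉ S, chainSum Q c i' < chainSum Q c i := by
  constructor
  · rintro ⟨j, rfl⟩
    refine ⟨Q.nonempty j, fun i hi => ?_, fun i hi i' hi' => ?_⟩
    · refine Finset.sum_pos' (fun l _ => ?_) ⟨j, Finset.mem_univ j, by rw [if_pos hi]; exact hc j⟩
      split_ifs
      exacts [(hc l).le, le_rfl]
    · refine Finset.sum_lt_sum (fun l _ => ?_) ⟨j, Finset.mem_univ j, ?_⟩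
      · by_cases h : i' ∈ Q.set l
        · have hjl : j ≤ l := by
            by_contra hlt
            exact hi' (Q.strictMono.monotone (not_le.1 hlt).le h)
          rw [if_pos h, if_pos (Q.strictMono.monotone hjl hi)]
        · rw [if_neg h]
          split_ifs
          exacts [(hc l).le, le_rfl]
      · rw [if_neg hi', if_pos hi]
        exact hc j
  · rintro ⟨hS, hpos, hlt⟩
    -- `Q j` is the first member of the chain that contains `S`.
    obtain ⟨j, hj, hmin⟩ := WellFounded.has_min wellFounded_lt {j | S ⊆ Q.set j}
      ⟨Fin.last n, fun i hi => by
        by_contra h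
        refine (hpos i hi).ne' (Finset.sum_eq_zero fun l _ => if_neg fun hl => h ?_)
        exact Q.subset_last l hl⟩
    refine ⟨j, Finset.Subset.antisymm (fun i' hi' => ?_) hj⟩
    by_contra hi'S
    obtain ⟨i, hi, hil⟩ := Q.exists_mem_forall_notMem hS fun l hl h => hmin l h hl
    refine (hlt i hi i' hi'S).not_ge (Finset.sum_le_sum fun l _ => ?_)
    by_cases h : i ∈ Q.set l
    · have hjl : j ≤ l := not_lt.1 fun hlj => hil l hlj h
      rw [if_pos h, if_pos (Q.strictMono.monotone hjl hi')]
    · rw [if_neg h]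
      split_ifs
      exacts [(hc l).le, le_rfl]

/-- The system is triangular: an element of `Q j` in no earlier member sees only the coefficients
from `c j` onwards. -/
theorem chainSum_injective (Q : SubsetChain n m) : Function.Injective (chainSum Q) := by
  intro c c' h
  funext j
  induction j using WellFoundedGT.induction with | ind j ih
  obtain ⟨i, hi, hil⟩ := Q.exists_mem_forall_notMem (Q.nonempty j)
    fun l (hl : l < j) h => (Q.strictMono hl).not_ge h
  have h0 : ∑ l, ((if i ∈ Q.set l then c l else 0) - if i ∈ Q.set l then c' l else 0) = 0 := by
    rw [Finset.sum_sub_distrib, sub_eq_zero]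
    exact congrFun h i
  rw [Finset.sum_eq_single j, if_pos hi, if_pos hi, sub_eq_zero] at h0
  · exact h0
  · intro l _ hlj
    rcases lt_or_gt_of_ne hlj with hl | hl
    · rw [if_neg (hil l hl), if_neg (hil l hl), sub_zero]
    · rw [ih l hl, sub_self]
  · exact fun h => absurd (Finset.mem_univ j) h

/-- The chain `Q(0) ⊂ ⋯ ⊂ Q(n) ⊂ S`. -/
def SubsetChain.snoc (Q : SubsetChain n m) (S : Finset (Fin (m + 1)))
    (h : Q.set (Fin.last n) ⊂ S) : SubsetChain (n + 1) m where
  set := Fin.snoc (α := fun _ => Finset (Fin (m + 1))) Q.set S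
  empty_ssubset := by
    have : Fin.snoc (α := fun _ => Finset (Fin (m + 1))) Q.set S 0 = Q.set 0 :=
      Fin.snoc_castSucc (α := fun _ => Finset (Fin (m + 1))) S Q.set 0
    rw [this]
    exact Q.empty_ssubset
  strictMono := by
    rw [Fin.strictMono_iff_lt_succ]
    intro i
    rw [Fin.snoc_castSucc]
    induction i using Fin.lastCases with
    | last => rwa [Fin.succ_last, Fin.snoc_last]
    | cast j =>
      rw [Fin.succ_castSucc, Fin.snoc_castSucc]
      exact Q.strictMono Fin.castSucc_lt_succ

theorem chainSum_snoc (Q : SubsetChain n m) (S : Finset (Fin (m + 1)))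
    (h : Q.set (Fin.last n) ⊂ S) (c : Fin (n + 1) → ℝ) (v : ℝ) (i : Fin (m + 1)) :
    chainSum (Q.snoc S h) (Fin.snoc (α := fun _ => ℝ) c v) i =
      chainSum Q c i + if i ∈ S then v else 0 := by
  rw [chainSum, Fin.sum_univ_castSucc]
  simp [SubsetChain.snoc, chainSum]

/-- Layer-cake decomposition: peel off the smallest nonzero value on the support, and induct on
the size of the support. -/
theorem exists_chainSum_eq (p : Fin (m + 1) → ℝ) (hp : ∀ i, 0 ≤ p i) (hne : ∃ i, p i ≠ 0) :
    ∃ (n : ℕ) (Q : SubsetChain n m) (c : Fin (n + 1) → ℝ), (∀ j, 0 ≤ c j) ∧ chainSum Q c = p ∧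
      Q.set (Fin.last n) ⊆ Finset.univ.filter fun i => p i ≠ 0 := by
  induction hN : (Finset.univ.filter fun i => p i ≠ 0).card using Nat.strong_induction_on
    generalizing p with | h N ih
  set S := Finset.univ.filter fun i => p i ≠ 0 with hSdef
  have hS : ∀ i, i ∈ S ↔ p i ≠ 0 := by simp [hSdef]
  have hSne : S.Nonempty := hne.imp fun i hi => (hS i).2 hi
  obtain ⟨i₀, hi₀, hmin⟩ := S.exists_min_image p hSne
  let p' : Fin (m + 1) → ℝ := fun i => p i - if i ∈ S then p i₀ else 0
  have hp' : ∀ i, p i = p' i + if i ∈ S then p i₀ else 0 := fun i => by simp [p']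
  have hp'0 : ∀ i ∉ S, p' i = 0 := fun i hi => by
    simp only [p', if_neg hi, sub_zero]
    exact not_not.1 fun h => hi ((hS i).2 h)
  by_cases hz : ∃ i, p' i ≠ 0
  · have hss : (Finset.univ.filter fun i => p' i ≠ 0) ⊂ S := by
      refine (Finset.ssubset_iff_of_subset fun i hi => ?_).2 ⟨i₀, hi₀, ?_⟩
      · by_contra h
        exact (Finset.mem_filter.1 hi).2 (hp'0 i h)
      · simp [p', hi₀]
    obtain ⟨n, Q, c, hc, hQ, hlast⟩ := ih _ (hN ▸ Finset.card_lt_card hss) p' (fun i => by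
      by_cases hi : i ∈ S
      · simp only [p', if_pos hi, sub_nonneg]
        exact hmin i hi
      · exact (hp'0 i hi).ge) hz rfl
    refine ⟨n + 1, Q.snoc S (lt_of_le_of_lt hlast hss), Fin.snoc (α := fun _ => ℝ) c (p i₀),
      fun j => ?_, ?_, ?_⟩
    · induction j using Fin.lastCases with
      | last => rw [Fin.snoc_last]; exact hp i₀
      | cast j => rw [Fin.snoc_castSucc]; exact hc j
    · funext i
      rw [chainSum_snoc, hQ, ← hp']
    · simp [SubsetChain.snoc]
  · refine ⟨0, ⟨fun _ => S, Finset.empty_ssubset.2 hSne,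
        fun a b h => absurd (Subsingleton.elim (α := Fin 1) a b) h.ne⟩,
      fun _ => p i₀, fun _ => hp i₀, ?_, subset_rfl⟩
    funext i
    have : p' i = 0 := not_not.1 fun h => hz ⟨i, h⟩
    rw [hp' i, this]
    simp [chainSum]

end LayerCake

/-! ### Barycentric subdivision is an isomorphism -/

theorem faceBarycenter_apply {m : ℕ} (S : Finset (Fin (m + 1))) (i : Fin (m + 1)) :
    faceBarycenter S i = if i ∈ S then (S.card : ℝ)⁻¹ else 0 := by
  simp [faceBarycenter, Finset.sum_apply, Pi.single_apply]

theorem baryMap_eq_chainSum {n m : ℕ} (Q : SubsetChain n m) (t : stdSimplex ℝ (Fin (n + 1))) :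
    (baryMap Q t : Fin (m + 1) → ℝ) = chainSum Q fun j => t j * ((Q.set j).card : ℝ)⁻¹ := by
  funext i
  change (∑ j, t j • faceBarycenter (Q.set j)) i = _
  simp [chainSum, Finset.sum_apply, faceBarycenter_apply]

theorem SubsetChain.card_ne_zero {n m : ℕ} (Q : SubsetChain n m) (j : Fin (n + 1)) :
    ((Q.set j).card : ℝ) ≠ 0 :=
  Nat.cast_ne_zero.2 (Q.nonempty j).card_ne_zero

theorem exists_baryMap_eq {m : ℕ} (p : stdSimplex ℝ (Fin (m + 1))) :
    ∃ (n : ℕ) (Q : SubsetChain n m) (t : stdSimplex ℝ (Fin (n + 1))), baryMap Q t = p := by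
  obtain ⟨i, hi⟩ := carrier_nonempty p
  obtain ⟨n, Q, c, hc, hQ, -⟩ := exists_chainSum_eq (p : Fin (m + 1) → ℝ)
    (fun i => p.2.1 i) ⟨i, mem_carrier.1 hi⟩
  refine ⟨n, Q, ⟨fun j => c j * (Q.set j).card, fun j => mul_nonneg (hc j) (Nat.cast_nonneg _),
    ?_⟩, ?_⟩
  · rw [← stdSimplex.sum_eq_one p, ← hQ]
    simp only [chainSum]
    rw [Finset.sum_comm]
    refine Finset.sum_congr rfl fun j _ => ?_
    simp [mul_comm]
  · ext1
    rw [baryMap_eq_chainSum]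
    refine Eq.trans (congrArg (chainSum Q) (funext fun j => ?_)) hQ
    exact mul_inv_cancel_right₀ (Q.card_ne_zero j) (c j)

/-- The interiors of the simplices of the barycentric subdivision are disjoint, and each is embedded:
a point `ψ_Q t` with `t` interior determines `Q` and `t`. -/
theorem baryMap_interior_injective {n n' m : ℕ} {Q : SubsetChain n m} {Q' : SubsetChain n' m}
    {t : stdSimplex ℝ (Fin (n + 1))} {t' : stdSimplex ℝ (Fin (n' + 1))}
    (ht : ∀ j, 0 < t j) (ht' : ∀ j, 0 < t' j) (h : baryMap Q t = baryMap Q' t') :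
    (⟨n, Q, t⟩ : Σ n, SubsetChain n m × stdSimplex ℝ (Fin (n + 1))) = ⟨n', Q', t'⟩ := by
  have hc : chainSum Q (fun j => t j * ((Q.set j).card : ℝ)⁻¹) =
      chainSum Q' fun j => t' j * ((Q'.set j).card : ℝ)⁻¹ := by
    rw [← baryMap_eq_chainSum, ← baryMap_eq_chainSum, h]
  have pos {n : ℕ} {Q : SubsetChain n m} {t : stdSimplex ℝ (Fin (n + 1))} (ht : ∀ j, 0 < t j)
      (j : Fin (n + 1)) : 0 < t j * ((Q.set j).card : ℝ)⁻¹ :=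
    mul_pos (ht j) (inv_pos.2 (Nat.cast_pos.2 (Q.nonempty j).card_pos))
  have hr : Set.range Q.set = Set.range Q'.set := by
    ext S
    rw [mem_range_set_iff Q (pos ht), mem_range_set_iff Q' (pos ht'), hc]
  obtain rfl : n = n' := by
    have := congrArg Set.ncard hr
    rw [← Set.image_univ, ← Set.image_univ, Set.ncard_image_of_injective _ Q.strictMono.injective,
      Set.ncard_image_of_injective _ Q'.strictMono.injective] at this
    simpa using this
  obtain rfl : Q = Q' := SubsetChain.ext ((StrictMono.range_inj Q.strictMono Q'.strictMono).1 hr)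
  congr 2
  ext j
  exact mul_right_cancel₀ (inv_ne_zero (Q.card_ne_zero j)) (congrFun (chainSum_injective Q hc) j)

/-- Each element of `M(-, m) ⊗ Δ•` is `Q ⊗ t` with `t` interior: restrict `Q` to the face carrying
the given point. -/
theorem exists_interior_rep {m : SemiSimplexCategory}
    (u : topTensor (baryModule.obj m) simplexFunctor) :
    ∃ (n : SemiSimplexCategory) (Q : SubsetChain n.len m.len)
      (t : stdSimplex ℝ (Fin (n.len + 1))), (∀ j, 0 < t j) ∧
      u = topTmul (Y := baryModule.obj m) (X := simplexFunctor) (b := n) Q t := by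
  induction u using Tensor.ind with | h n Q t
  change stdSimplex ℝ (Fin (n.len + 1)) at t
  obtain ⟨k, f, hf⟩ := exists_face_eq (m := n) (carrier_nonempty t)
  obtain ⟨s, rfl⟩ := exists_stdSimplex_map_eq (homEquiv f) t fun i hi =>
    mem_face.1 (hf ▸ mem_carrier.2 hi)
  refine ⟨k, SubsetChain.restrict (homEquiv f) Q, s, fun j => ?_,
    (Tensor.tmul_glue (X := simplexFunctor ⋙ forget TopCat) f Q s).symm⟩
  refine lt_of_le_of_ne (s.2.1 j) (Ne.symm (mem_carrier.1 ?_))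
  rw [carrier_map, face] at hf
  exact Finset.map_injective _ hf ▸ Finset.mem_univ j

theorem bijective_baryAlgebra_app (m : SemiSimplexCategory) :
    Function.Bijective (baryAlgebra.app m) := by
  constructor
  · intro u u' h
    obtain ⟨⟨n⟩, Q, t, ht, rfl⟩ := exists_interior_rep u
    obtain ⟨⟨n'⟩, Q', t', ht', rfl⟩ := exists_interior_rep u'
    exact congrArg (fun r : Σ n, SubsetChain n m.len × stdSimplex ℝ (Fin (n + 1)) =>
      topTmul (Y := baryModule.obj m) (X := simplexFunctor) (b := ⟨r.1⟩) r.2.1 r.2.2)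
      (baryMap_interior_injective ht ht' h)
  · intro p
    obtain ⟨n, Q, t, h⟩ := exists_baryMap_eq (m := m.len) p
    exact ⟨topTmul (Y := baryModule.obj m) (X := simplexFunctor) (b := ⟨n⟩) Q t, h⟩

/-- Each component is a continuous bijection from a compact space, a finite union of images of
simplices, to a Hausdorff space. -/
instance isIso_baryAlgebra : IsIso baryAlgebra := by
  rw [NatTrans.isIso_iff_isIso_app]
  intro m
  have : CompactSpace (topTensor (baryModule.obj m) simplexFunctor) := by
    refine ⟨?_⟩
    have h : (Set.univ : Set (topTensor (baryModule.obj m) simplexFunctor)) =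
        ⋃ p : Σ n : SemiSimplexCategory, SubsetChain n.len m.len,
          Set.range fun t : simplexFunctor.obj p.1 =>
            topTmul (Y := baryModule.obj m) (X := simplexFunctor) (b := p.1) p.2 t := by
      refine (Set.eq_univ_of_forall fun u => ?_).symm
      induction u using Tensor.ind with | h n Q t
      exact Set.mem_iUnion.2 ⟨⟨n, Q⟩, t, rfl⟩
    rw [h]
    refine isCompact_iUnion fun p => ?_
    have : CompactSpace (simplexFunctor.obj p.1) :=
      inferInstanceAs (CompactSpace (stdSimplex ℝ (Fin (p.1.len + 1))))
    exact isCompact_range (continuous_topTmul _)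
  have : CompactSpace (((moduleTensor baryModule).obj simplexFunctor).obj m) := this
  have : T2Space (simplexFunctor.obj m) :=
    inferInstanceAs (T2Space (stdSimplex ℝ (Fin (m.len + 1))))
  exact TopCat.isIso_of_bijective_of_isClosedMap _ (bijective_baryAlgebra_app m)
    (baryAlgebra.app m).hom.continuous.isClosedMap

/-! ### Contraction under barycentric subdivision -/

/-- The `ℓ¹` distance between two points of a simplex. -/
def dist₁ {n : ℕ} (s t : stdSimplex ℝ (Fin (n + 1))) : ℝ :=
  ∑ i, |s i - t i|

theorem dist₁_le_two {n : ℕ} (s t : stdSimplex ℝ (Fin (n + 1))) : dist₁ s t ≤ 2 := by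
  calc dist₁ s t ≤ ∑ i, (s i + t i) := Finset.sum_le_sum fun i _ =>
        abs_sub_le_iff.2 ⟨by linarith [t.2.1 i, show 0 ≤ t i from t.2.1 i],
          by linarith [show 0 ≤ s i from s.2.1 i]⟩
    _ = 2 := by
      rw [Finset.sum_add_distrib, stdSimplex.sum_eq_one, stdSimplex.sum_eq_one]
      norm_num

theorem dist_le_dist₁ {n : ℕ} (s t : stdSimplex ℝ (Fin (n + 1))) : dist s t ≤ dist₁ s t := by
  refine (dist_pi_le_iff (Finset.sum_nonneg fun i _ => abs_nonneg _)).2 fun i => ?_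
  exact Finset.single_le_sum (f := fun i => |s i - t i|) (fun i _ => abs_nonneg _)
    (Finset.mem_univ i)

/-- The contraction factor of barycentric subdivision in dimensions at most `N`. -/
def factor (N : ℕ) : ℝ := 1 - ((N : ℝ) + 1)⁻¹

theorem factor_nonneg (N : ℕ) : 0 ≤ factor N :=
  sub_nonneg.2 (inv_le_one_of_one_le₀ (by linarith [Nat.cast_nonneg (α := ℝ) N]))

theorem factor_lt_one (N : ℕ) : factor N < 1 :=
  sub_lt_self 1 (inv_pos.2 (by positivity))

/-- A Doeblin-type estimate: the vertices `b j` of the simplex `ψ_Q(Δⁿ)` all give mass at least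
`(N + 1)⁻¹` to any fixed vertex `i₀ ∈ Q 0`. This common mass cancels in differences, because the
coordinates of a point of `Δⁿ` always add up to `1`. -/
theorem dist₁_baryMap_le {n m N : ℕ} (hN : m ≤ N) (Q : SubsetChain n m)
    (s t : stdSimplex ℝ (Fin (n + 1))) :
    dist₁ (baryMap Q s) (baryMap Q t) ≤ factor N * dist₁ s t := by
  obtain ⟨i₀, hi₀⟩ := Q.nonempty 0
  let e : Fin (m + 1) → ℝ := fun i => if i = i₀ then ((N : ℝ) + 1)⁻¹ else 0
  let b : Fin (n + 1) → Fin (m + 1) → ℝ := fun j => faceBarycenter (Q.set j)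
  have hbe : ∀ j i, 0 ≤ b j i - e i := by
    intro j i
    simp only [b, e, faceBarycenter_apply, sub_nonneg]
    by_cases hi : i = i₀
    · subst hi
      rw [if_pos rfl, if_pos (Q.strictMono.monotone (Fin.zero_le j) hi₀)]
      have h1 : (Q.set j).card ≤ N + 1 := by
        have := Finset.card_le_univ (Q.set j)
        rw [Fintype.card_fin] at this
        omega
      exact inv_anti₀ (Nat.cast_pos.2 (Q.nonempty j).card_pos) (by exact_mod_cast h1)
    · rw [if_neg hi]
      split_ifs <;> positivity
  have hsum : ∀ j, ∑ i, (b j i - e i) = factor N := by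
    intro j
    rw [Finset.sum_sub_distrib, show ∑ i, b j i = 1 from (faceBarycenter_mem (Q.nonempty j)).2]
    simp [e, factor]
  have hdiff : ∀ i, baryMap Q s i - baryMap Q t i = ∑ j, (s j - t j) * (b j i - e i) := by
    intro i
    have h0 : ∑ j, (s j - t j) = 0 := by
      rw [Finset.sum_sub_distrib, stdSimplex.sum_eq_one, stdSimplex.sum_eq_one, sub_self]
    have h (t : stdSimplex ℝ (Fin (n + 1))) : baryMap Q t i = ∑ j, t j * b j i := by
      change (∑ j, t j • faceBarycenter (Q.set j)) i = _
      simp [Finset.sum_apply, b]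
    simp only [mul_sub, Finset.sum_sub_distrib, ← Finset.sum_mul, h0, zero_mul, sub_zero]
    rw [h, h, ← Finset.sum_sub_distrib]
    simp only [sub_mul]
  calc dist₁ (baryMap Q s) (baryMap Q t)
      = ∑ i, |∑ j, (s j - t j) * (b j i - e i)| := by simp only [dist₁, hdiff]
    _ ≤ ∑ i, ∑ j, |s j - t j| * (b j i - e i) := Finset.sum_le_sum fun i _ =>
        (Finset.abs_sum_le_sum_abs _ _).trans_eq (Finset.sum_congr rfl fun j _ => by
          rw [abs_mul, abs_of_nonneg (hbe j i)])
    _ = factor N * dist₁ s t := by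
      rw [Finset.sum_comm]
      simp only [← Finset.mul_sum, hsum, ← Finset.sum_mul, dist₁, mul_comm]

/-! ### The topology of `Y ⊗ X` -/

instance finite_sigma_hom (m : SemiSimplexCategory) :
    Finite (Σ k : SemiSimplexCategory, k ⟶ m) :=
  Finite.of_injective (fun p => face p.2) fun _ _ h => sigma_hom_ext h

theorem isClosed_topTensor {A : Type u} [SmallCategory A] {Y : Aᵒᵖ ⥤ Type u} {X : A ⥤ TopCat.{u}}
    {S : Set (topTensor Y X)}
    (h : ∀ (b : A) (y : Y.obj (op b)), IsClosed {x : X.obj b | topTmul y x ∈ S}) : IsClosed S := by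
  rw [← isOpen_compl_iff]
  exact continuous_Prop.1 (continuous_topTensor_dom (h := fun u => u ∉ S)
    fun b y => continuous_Prop.2 (h b y).isOpen_compl)

/-- The preimage of `y ⊗ C` under `y' ⊗ -` is the union of the sets `f' (f⁻¹ C)` over the
finitely many spans `(f, f')` with `y f = y' f'`. -/
theorem isClosedMap_topTmul {X : SemiSimplexCategory ⥤ TopCat.{0}} (hX : NondegenerateTop X)
    {Y : SemiSimplexCategoryᵒᵖ ⥤ Type} {b : SemiSimplexCategory} (y : Y.obj (op b)) :
    IsClosedMap fun x : X.obj b => (topTmul y x : topTensor Y X) := by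
  intro C hC
  refine isClosed_topTensor fun b' y' => ?_
  let I := {p : Σ k : SemiSimplexCategory, (k ⟶ b) × (k ⟶ b') //
    Y.map p.2.1.op y = Y.map p.2.2.op y'}
  have : Finite (Σ k : SemiSimplexCategory, (k ⟶ b) × (k ⟶ b')) :=
    Finite.of_injective
      (β := (Σ k : SemiSimplexCategory, k ⟶ b) × (Σ k : SemiSimplexCategory, k ⟶ b'))
      (fun p => (⟨p.1, p.2.1⟩, ⟨p.1, p.2.2⟩)) (by
        rintro ⟨k, f, f'⟩ ⟨l, g, g'⟩ h
        obtain ⟨h1, h2⟩ := Prod.mk.inj h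
        obtain ⟨rfl, h1⟩ := Sigma.mk.inj h1
        obtain rfl := eq_of_heq h1
        obtain rfl := eq_of_heq (Sigma.mk.inj h2).2
        rfl)
  have heq : {x' : X.obj b' | topTmul y' x' ∈ (fun x => (topTmul y x : topTensor Y X)) '' C} =
      ⋃ p : I, X.map p.1.2.2 '' (X.map p.1.2.1 ⁻¹' C) := by
    ext x'
    simp only [Set.mem_ofPred_eq, Set.mem_image, Set.mem_iUnion, Set.mem_preimage]
    constructor
    · rintro ⟨x, hx, h⟩
      obtain ⟨k, f, f', z, h1, h2, h3⟩ := Tensor.exists_span_of_eq hX.1 h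
      refine ⟨⟨⟨k, f, f'⟩, h1⟩, z, ?_, h3⟩
      have h2' : X.map f z = x := h2
      rwa [h2']
    · rintro ⟨⟨⟨k, f, f'⟩, h⟩, z, hz, rfl⟩
      refine ⟨X.map f z, hz, ?_⟩
      have e1 := Tensor.tmul_glue (X := X ⋙ forget TopCat) f y z
      have e2 := Tensor.tmul_glue (X := X ⋙ forget TopCat) f' y' z
      dsimp only at h
      rw [h] at e1
      exact e1.symm.trans e2
  rw [heq]
  exact isClosed_iUnion_of_finite fun p =>
    hX.2 _ _ (hC.preimage (X.map p.1.2.1).hom.continuous)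

/-! ### Smallest carrying faces in a nondegenerate functor -/

section Support

variable {X : SemiSimplexCategory ⥤ Type}

open scoped Classical in
/-- The smallest face carrying `x`: the intersection of the images of all `f` such that `x` lies in
the image of `X f`. -/
def supp {n : SemiSimplexCategory} (x : X.obj n) : Finset (Fin (n.len + 1)) :=
  Finset.univ.filter fun i =>
    ∀ (k : SemiSimplexCategory) (f : k ⟶ n) (z : X.obj k), X.map f z = x → i ∈ face f

theorem mem_supp {n : SemiSimplexCategory} {x : X.obj n} {i : Fin (n.len + 1)} :
    i ∈ supp x ↔
      ∀ (k : SemiSimplexCategory) (f : k ⟶ n) (z : X.obj k), X.map f z = x → i ∈ face f := by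
  simp [supp]

theorem supp_map (hX : Nondegenerate X) {n m : SemiSimplexCategory} (g : n ⟶ m) (x : X.obj n) :
    supp (X.map g x) = (supp x).map (homEquiv g).toEmbedding := by
  ext i
  rw [Finset.mem_map]
  constructor
  · intro hi
    obtain ⟨j, rfl⟩ := mem_face.1 (mem_supp.1 hi n g x rfl)
    refine ⟨j, mem_supp.2 fun k f z hz => ?_, rfl⟩
    have := mem_supp.1 hi k (f ≫ g) z (by simp [hz])
    rw [face_comp] at this
    exact (Finset.mem_map' _).1 this
  · rintro ⟨j, hj, rfl⟩
    refine mem_supp.2 fun k f z hz => ?_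
    obtain ⟨l, h, h', w, e, -, h2⟩ := hX.exists_span f g z x hz
    have h3 : homEquiv g j ∈ face (h' ≫ g) := by
      rw [face_comp]
      exact Finset.mem_map_of_mem (homEquiv g).toEmbedding (mem_supp.1 hj l h' w h2)
    rw [← e] at h3
    exact face_comp_subset h f h3

/-- A face of least cardinality carrying `x` is contained in every face carrying `x`. -/
theorem supp_nonempty (hX : Nondegenerate X) {n : SemiSimplexCategory} (x : X.obj n) :
    (supp x).Nonempty := by
  obtain ⟨⟨k, f⟩, ⟨z, hz⟩, hmin⟩ := exists_minimalFor_of_wellFoundedLT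
    (fun p : Σ k : SemiSimplexCategory, k ⟶ n => ∃ z, X.map p.2 z = x) (fun p => (face p.2).card)
    ⟨⟨n, 𝟙 n⟩, x, by simp⟩
  refine Finset.Nonempty.mono (s := face f) (fun i hi => mem_supp.2 fun k' f' z' hz' => ?_)
    (Finset.card_pos.1 (by rw [card_face]; exact Nat.succ_pos _))
  obtain ⟨l, h, h', w, e, h1, -⟩ := hX.exists_span f f' z z' (hz.trans hz'.symm)
  have hcard : (face f).card ≤ (face (h ≫ f)).card :=
    hmin (j := ⟨l, h ≫ f⟩) ⟨w, by simp [h1, hz]⟩ (Finset.card_le_card (face_comp_subset h f))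
  rw [← Finset.eq_of_subset_of_card_le (face_comp_subset h f) hcard, e] at hi
  exact face_comp_subset h' f' hi

end Support

/-! ### The fixed-point operator of a coalgebra -/

section Iteration

variable {X : SemiSimplexCategory ⥤ TopCat.{0}}

/-- Families of maps `X n → Δⁿ` that are natural, but not necessarily continuous: natural
transformations between the underlying set-valued functors. -/
abbrev SetTrans (X : SemiSimplexCategory ⥤ TopCat.{0}) :=
  X ⋙ forget TopCat.{0} ⟶ simplexFunctor ⋙ forget TopCat.{0}

namespace SetTrans

/-- The map `X n → Δⁿ` belonging to `θ`. -/
def eval (θ : SetTrans X) {n : SemiSimplexCategory} (x : X.obj n) :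
    stdSimplex ℝ (Fin (n.len + 1)) :=
  θ.app n x

theorem eval_map (θ : SetTrans X) {n m : SemiSimplexCategory} (f : n ⟶ m) (x : X.obj n) :
    θ.eval (X.map f x) = stdSimplex.map (homEquiv f) (θ.eval x) :=
  NatTrans.naturality_apply θ f x

theorem ext_eval {θ θ' : SetTrans X}
    (h : ∀ (n : SemiSimplexCategory) (x : X.obj n), θ.eval x = θ'.eval x) : θ = θ' := by
  ext n x
  exact h n x

/-- The set-level natural transformation given by a natural family of maps. -/
def ofEval (φ : ∀ n : SemiSimplexCategory, X.obj n → stdSimplex ℝ (Fin (n.len + 1)))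
    (h : ∀ {n m : SemiSimplexCategory} (f : n ⟶ m) (x : X.obj n),
      φ m (X.map f x) = stdSimplex.map (homEquiv f) (φ n x)) : SetTrans X where
  app n := TypeCat.ofHom (φ n)
  naturality n m f := by
    ext x
    exact h f x

/-- The map `M(-, m) ⊗ X → Δᵐ`, `Q ⊗ z ↦ ψ_Q (θ z)`. -/
def tensorEval (θ : SetTrans X) {m : SemiSimplexCategory} (u : topTensor (baryModule.obj m) X) :
    stdSimplex ℝ (Fin (m.len + 1)) :=
  baryAlgebra.app m (Tensor.map (𝟙 (baryModule.obj m)) θ u)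

variable (ξ : X ⟶ (moduleTensor baryModule).obj X)

/-- The operator `θ ↦ ψ ∘ (M ⊗ θ) ∘ ξ`, whose continuous fixed points are the coalgebra maps from
`(X, ξ)` to `(Δ•, ψ⁻¹)`. -/
def step (θ : SetTrans X) : SetTrans X :=
  ofEval (fun m x => θ.tensorEval (ξ.app m x)) fun {m m'} f x => by
    have h : ξ.app m' (X.map f x) = topTensorMap (baryModule.map f) (𝟙 X) (ξ.app m x) :=
      NatTrans.naturality_apply ξ f x
    rw [h]
    generalize ξ.app m x = u
    induction u using Tensor.ind with | h n Q z
    exact baryMap_image (homEquiv f) Q (θ.eval (n := n) z)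

theorem eval_step (θ : SetTrans X) {m : SemiSimplexCategory} (x : X.obj m) :
    (step ξ θ).eval x = θ.tensorEval (ξ.app m x) := rfl

theorem dist₁_step_le {N : ℕ} {ε : ℝ} {θ θ' : SetTrans X}
    (h : ∀ (m : SemiSimplexCategory), m.len ≤ N → ∀ x : X.obj m,
      dist₁ (θ.eval x) (θ'.eval x) ≤ ε)
    (m : SemiSimplexCategory) (hm : m.len ≤ N) (x : X.obj m) :
    dist₁ ((step ξ θ).eval x) ((step ξ θ').eval x) ≤ factor N * ε := by
  rw [eval_step, eval_step]
  generalize ξ.app m x = u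
  induction u using Tensor.ind with | h n Q z
  exact (dist₁_baryMap_le hm Q (θ.eval (n := n) z) (θ'.eval (n := n) z)).trans
    (mul_le_mul_of_nonneg_left (h n ((SubsetChain.len_le Q).trans hm) z) (factor_nonneg N))

theorem dist₁_iterate_le (θ θ' : SetTrans X) (N k : ℕ) (m : SemiSimplexCategory)
    (hm : m.len ≤ N) (x : X.obj m) :
    dist₁ (((step ξ)^[k] θ).eval x) (((step ξ)^[k] θ').eval x) ≤ 2 * factor N ^ k := by
  induction k generalizing m with
  | zero => simpa using dist₁_le_two _ _
  | succ k ih =>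
    rw [Function.iterate_succ_apply', Function.iterate_succ_apply']
    exact (dist₁_step_le ξ ih m hm x).trans_eq (by ring)

theorem tendsto_two_mul_factor_pow (N : ℕ) :
    Filter.Tendsto (fun k : ℕ => 2 * factor N ^ k) Filter.atTop (nhds 0) := by
  simpa using (tendsto_pow_atTop_nhds_zero_of_lt_one (factor_nonneg N)
    (factor_lt_one N)).const_mul 2

theorem eq_of_step_eq {θ θ' : SetTrans X} (h : step ξ θ = θ) (h' : step ξ θ' = θ') : θ = θ' := by
  refine ext_eval fun m x => ?_
  have hk (k : ℕ) : dist (θ.eval x) (θ'.eval x) ≤ 2 * factor m.len ^ k := by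
    have := dist₁_iterate_le ξ θ θ' m.len k m le_rfl x
    rw [Function.iterate_fixed h, Function.iterate_fixed h'] at this
    exact (dist_le_dist₁ _ _).trans this
  exact dist_le_zero.1 (ge_of_tendsto' (tendsto_two_mul_factor_pow m.len) hk)

/-- Sending an element to the barycenter of the smallest face carrying it is natural. -/
theorem nonempty_of_nondegenerate (hX : Nondegenerate (X ⋙ forget TopCat.{0})) :
    Nonempty (SetTrans X) := by
  let Q {n : SemiSimplexCategory} (x : (X ⋙ forget TopCat.{0}).obj n) : SubsetChain 0 n.len :=
    ⟨fun _ => supp x, Finset.empty_ssubset.2 (supp_nonempty hX x),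
      fun a b h => absurd (Subsingleton.elim (α := Fin 1) a b) h.ne⟩
  refine ⟨ofEval (fun n x => baryMap (Q (n := n) x) default) fun {n m} f x => ?_⟩
  rw [← baryMap_image]
  congr 1
  exact SubsetChain.ext (funext fun _ => supp_map hX f x)

/-- The iterates of `step ξ` converge, uniformly in each dimension, to a fixed point. -/
theorem exists_step_eq (hX : Nondegenerate (X ⋙ forget TopCat.{0})) :
    ∃ θ : SetTrans X, step ξ θ = θ := by
  obtain ⟨θ₀⟩ := nonempty_of_nondegenerate hX
  have hlim (m : SemiSimplexCategory) (x : X.obj m) : ∃ p, Filter.Tendsto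
      (fun k => ((step ξ)^[k] θ₀).eval x) Filter.atTop (nhds p) := by
    refine cauchySeq_tendsto_of_complete (cauchySeq_of_le_geometric (factor m.len) 2
      (factor_lt_one _) fun k => (dist_le_dist₁ _ _).trans ?_)
    rw [Function.iterate_succ_apply]
    exact dist₁_iterate_le ξ θ₀ (step ξ θ₀) m.len k m le_rfl x
  choose φ hφ using hlim
  let θ : SetTrans X := ofEval φ fun {n m} f x => by
    refine tendsto_nhds_unique (hφ m (X.map f x)) ?_
    simp only [eval_map]
    exact ((stdSimplex.continuous_map (homEquiv f)).tendsto _).comp (hφ n x)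
  refine ⟨θ, ext_eval fun m x => tendsto_nhds_unique ?_ (hφ m x)⟩
  rw [← Filter.tendsto_add_atTop_iff_nat 1]
  simp only [Function.iterate_succ_apply', eval_step]
  generalize ξ.app m x = u
  induction u using Tensor.ind with | h n Q z
  exact ((continuous_baryMap Q).tendsto _).comp (hφ n z)

/-- If the oscillation of a fixed point `θ` at every point is at most `ε`, then it is at most
`factor N * ε`: the maps `Q ⊗ -` are closed and finite in number, so a neighbourhood of `ξ x` can
be tested on neighbourhoods of the points `z` with `Q ⊗ z = ξ x`. -/
theorem eventually_dist₁_le_of_step_eq (hX : NondegenerateTop X) {θ : SetTrans X}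
    (hθ : step ξ θ = θ) {N : ℕ} {ε : ℝ}
    (h : ∀ (m : SemiSimplexCategory), m.len ≤ N → ∀ x : X.obj m,
      ∀ᶠ y in nhds x, dist₁ (θ.eval y) (θ.eval x) ≤ ε)
    (m : SemiSimplexCategory) (hm : m.len ≤ N) (x : X.obj m) :
    ∀ᶠ y in nhds x, dist₁ (θ.eval y) (θ.eval x) ≤ factor N * ε := by
  rw [← hθ]
  simp only [eval_step]
  refine (ξ.app m).hom.continuous.continuousAt.eventually
    (p := fun u => dist₁ (θ.tensorEval u) (θ.tensorEval (ξ.app m x)) ≤ factor N * ε) ?_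
  change ∀ᶠ v : topTensor (baryModule.obj m) X in nhds (ξ.app m x),
    dist₁ (θ.tensorEval v) (θ.tensorEval (ξ.app m x)) ≤ factor N * ε
  generalize (ξ.app m x : topTensor (baryModule.obj m) X) = u
  let q (p : Σ n : SemiSimplexCategory, SubsetChain n.len m.len) (z : X.obj p.1) :
    topTensor (baryModule.obj m) X := topTmul (Y := baryModule.obj m) p.2 z
  let B : Set (topTensor (baryModule.obj m) X) :=
    {v | ¬ dist₁ (θ.tensorEval v) (θ.tensorEval u) ≤ factor N * ε}
  have hB : B ⊆ ⋃ p, q p '' closure (q p ⁻¹' B) := by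
    intro v hv
    induction v using Tensor.ind with | h n Q z
    exact Set.mem_iUnion.2 ⟨⟨n, Q⟩, z, subset_closure hv, rfl⟩
  have hclosed : IsClosed (⋃ p, q p '' closure (q p ⁻¹' B)) :=
    isClosed_iUnion_of_finite fun p => isClosedMap_topTmul hX _ _ isClosed_closure
  have huB : u ∉ ⋃ p, q p '' closure (q p ⁻¹' B) := by
    intro hu
    obtain ⟨⟨n, Q⟩, z, hz, rfl⟩ := Set.mem_iUnion.1 hu
    obtain ⟨y, hy, hyB⟩ := mem_closure_iff_nhds.1 hz _
      (h n ((SubsetChain.len_le Q).trans hm) z)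
    exact hyB ((dist₁_baryMap_le hm Q (θ.eval y) (θ.eval z)).trans
      (mul_le_mul_of_nonneg_left hy (factor_nonneg N)))
  filter_upwards [hclosed.isOpen_compl.mem_nhds huB] with v hv
  by_contra hvB
  exact hv (hB hvB)

/-- The oscillation of a fixed point is at most `2 * factor N ^ k` for all `k`, hence zero. -/
theorem continuous_of_step_eq (hX : NondegenerateTop X) {θ : SetTrans X} (hθ : step ξ θ = θ)
    (m : SemiSimplexCategory) : Continuous fun x : X.obj m => θ.eval x := by
  have hk (k : ℕ) : ∀ (n : SemiSimplexCategory), n.len ≤ m.len → ∀ x : X.obj n,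
      ∀ᶠ y in nhds x, dist₁ (θ.eval y) (θ.eval x) ≤ 2 * factor m.len ^ k := by
    induction k with
    | zero =>
      refine fun n _ x => Filter.Eventually.of_forall fun y => ?_
      simpa using dist₁_le_two _ _
    | succ k ih =>
      intro n hn x
      filter_upwards [eventually_dist₁_le_of_step_eq ξ hX hθ ih n hn x] with y hy
      exact hy.trans_eq (by ring)
  refine continuous_iff_continuousAt.2 fun x => Metric.tendsto_nhds.2 fun ε hε => ?_
  obtain ⟨k, hkε⟩ := ((tendsto_two_mul_factor_pow m.len).eventually (gt_mem_nhds hε)).exists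
  filter_upwards [hk k m le_rfl x] with y hy
  exact ((dist_le_dist₁ _ _).trans hy).trans_lt hkε

end SetTrans

/-! ### Terminality -/

/-- The equation says that `φ` is a map of coalgebras from `(X, ξ)` to `(Δ•, ψ⁻¹)`. -/
theorem existsUnique_algebra_map (hX : NondegenerateTop X)
    (ξ : X ⟶ (moduleTensor baryModule).obj X) :
    ∃! φ : X ⟶ simplexFunctor, ξ ≫ (moduleTensor baryModule).map φ ≫ baryAlgebra = φ := by
  have key (φ : X ⟶ simplexFunctor)
      (h : ξ ≫ (moduleTensor baryModule).map φ ≫ baryAlgebra = φ) :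
      SetTrans.step ξ (Functor.whiskerRight φ (forget TopCat.{0})) =
        Functor.whiskerRight φ (forget TopCat.{0}) :=
    SetTrans.ext_eval fun m x => ConcreteCategory.congr_hom (NatTrans.congr_app h m) x
  obtain ⟨θ, hθ⟩ := SetTrans.exists_step_eq ξ hX.1
  let φ : X ⟶ simplexFunctor :=
    { app := fun m => TopCat.ofHom (Y := simplexFunctor.obj m)
        ⟨fun x => θ.eval x, SetTrans.continuous_of_step_eq ξ hX hθ m⟩
      naturality := fun n m f => by
        ext x
        exact θ.eval_map f x }
  refine ⟨φ, ?_, fun φ' h => ?_⟩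
  · ext m x
    exact congrArg (fun θ : SetTrans X => θ.eval (n := m) x) hθ
  · have h' := SetTrans.eq_of_step_eq ξ (key φ' h) hθ
    ext m x
    exact congrArg (fun θ : SetTrans X => θ.eval (n := m) x) h'

end Iteration

theorem isUniversalSolution_simplexFunctor :
    IsUniversalSolution baryModule
      ⟨⟨simplexFunctor, inv baryAlgebra⟩, nondegenerate_simplexFunctor⟩ := by
  refine ⟨IsTerminal.ofUniqueHom (fun C => ObjectProperty.homMk
    ⟨(existsUnique_algebra_map C.property C.obj.str).choose, ?_⟩) fun C f => ?_⟩
  · have h := (existsUnique_algebra_map C.property C.obj.str).choose_spec.1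
    rw [IsIso.eq_comp_inv, Category.assoc]
    exact h
  · have h := f.hom.h
    rw [IsIso.eq_comp_inv, Category.assoc] at h
    ext1
    ext1
    exact (existsUnique_algebra_map C.property C.obj.str).choose_spec.2 _ h

end SelfSim

end

theorem mainTheorem7 :
    SelfSim.IsEquationalSystem SelfSim.baryModule ∧
      ∃ (hnd : SelfSim.NondegenerateTop SelfSim.simplexFunctor)
        (_ : CategoryTheory.IsIso SelfSim.baryAlgebra),
        SelfSim.IsUniversalSolution SelfSim.baryModule
          ⟨⟨SelfSim.simplexFunctor, CategoryTheory.inv SelfSim.baryAlgebra⟩, hnd⟩ :=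
  ⟨SelfSim.isEquationalSystem_baryModule, SelfSim.nondegenerate_simplexFunctor,
    SelfSim.isIso_baryAlgebra, SelfSim.isUniversalSolution_simplexFunctor⟩
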